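/- Let $\Bbbk$ be an algebraically closed field of characteristic $0$, let $g\in\mathbb N$, and let $\Bbbk\langle x_1,\dots,x_g\rangle$ be the free $\Bbbk$-algebra on $g$ freely noncommuting variables. The free locus of a noncommutative polynomial $f\in\Bbbk\langle x_1,\dots,x_g\rangle$ is the set $$\mathscr Z(f)=\bigsqcup_{n\ge 1}\{X\in M_n(\Bbbk)^g : \det f(X)=0\}.$$ A monic pencil of size $d\ge1$ is $L=I_d-\sum_{j=1}^g A_jx_j$ with $A_1,\dots,A_g\in M_d(\Bbbk)$, and its free locus is $$\mathscr Z(L)=\bigsqcup_{n\ge 1}\Big\{X\in M_n(\Bbbk)^g : \det\Big(I_{dn}-\sum_{j=1}^g A_j\otimes X_j\Big)=0\Big\}.$$ The pencil $L$ is called flip-poly if there are matrices $N_j,E_j\in M_d(\Bbbk)$ with $A_j=N_j+E_j$ for $j=1,\dots,g$ such that $N_1,\dots,N_g$ are jointly nilpotent (for some $m$, every product of $m$ of the matrices $N_j$, repetitions allowed, is zero) and $\bigcap_{j=1}^g\ker E_j$ has codimension at most $1$ in $\Bbbk^d$. Then the set of free loci of noncommutative polynomials with nonzero constant term coincides with the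 set of free loci of flip-poly pencils: $$\{\mathscr Z(f) : f\in\Bbbk\langle x_1,\dots,x_g\rangle,\ f(0)\neq0\}=\{\mathscr Z(L) : L \text{ a flip-poly monic pencil in } x_1,\dots,x_g\}.$$ -/

import Mathlib

open scoped Kronecker

namespace FreeLoci

/-- The space of all `g`-tuples of square matrices of equal size `n ≥ 1` over `K`: the disjoint
union over `n` of the spaces of `g`-tuples of `n × n` matrices. -/
abbrev MatTuple (K : Type*) (g : ℕ) : Type _ :=
  Σ n : ℕ+, Fin g → Matrix (Fin n) (Fin n) K

/-- The free algebra of noncommutative polynomials in `g` freely noncommuting variables. -/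
abbrev NCPoly (K : Type*) [Field K] (g : ℕ) : Type _ := FreeAlgebra K (Fin g)

/-- Evaluation of a noncommutative polynomial at a tuple of elements of a `K`-algebra. -/
def NCPoly.eval {K : Type*} [Field K] {g : ℕ} {R : Type*} [Ring R] [Algebra K R]
    (X : Fin g → R) (f : NCPoly K g) : R :=
  FreeAlgebra.lift K X f

/-- The free locus of a noncommutative polynomial `f`: all `X` with `det f(X) = 0`. -/
def NCPoly.freeLocus {K : Type*} [Field K] {g : ℕ} (f : NCPoly K g) : Set (MatTuple K g) :=
  {X | (NCPoly.eval X.2 f).det = 0}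

/-- A monic linear pencil `L = I - ∑ j, A j * x j` of size `d ≥ 1`, given by its coefficients. -/
structure MonicPencil (K : Type*) (g : ℕ) where
  /-- The size `d` of the pencil. -/
  size : ℕ+
  /-- The coefficients `A j`. -/
  coeff : Fin g → Matrix (Fin size) (Fin size) K

/-- The evaluation `L(X) = I - ∑ j, A j ⊗ X j` at a tuple of `n × n` matrices. -/
def MonicPencil.eval {K : Type*} [Field K] {g : ℕ} (L : MonicPencil K g) {n : ℕ}
    (X : Fin g → Matrix (Fin n) (Fin n) K) :
    Matrix (Fin L.size × Fin n) (Fin L.size × Fin n) K :=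
  1 - ∑ j, L.coeff j ⊗ₖ X j

/-- The free locus of a monic pencil `L`: all `X` with `det L(X) = 0`. -/
def MonicPencil.freeLocus {K : Type*} [Field K] {g : ℕ} (L : MonicPencil K g) :
    Set (MatTuple K g) :=
  {X | (L.eval X.2).det = 0}

/-- Matrices `N 1, …, N g` are jointly nilpotent if for some `m` all products of `m` of them
(with repetitions, in any order) vanish. -/
def JointlyNilpotent {K : Type*} [Field K] {g d : ℕ}
    (N : Fin g → Matrix (Fin d) (Fin d) K) : Prop :=
  ∃ m : ℕ, ∀ w : List (Fin g), w.length = m → (w.map N).prod = 0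

/-- A monic pencil is flip-poly if its coefficients are `N j + E j` with `N` jointly nilpotent and
the common kernel of the `E j` of codimension at most one. -/
def MonicPencil.IsFlipPoly {K : Type*} [Field K] {g : ℕ} (L : MonicPencil K g) : Prop :=
  ∃ N E : Fin g → Matrix (Fin L.size) (Fin L.size) K,
    (∀ j, L.coeff j = N j + E j) ∧
    JointlyNilpotent N ∧
    Module.finrank K ((Fin L.size → K) ⧸ ⨅ j, LinearMap.ker (Matrix.toLin' (E j))) ≤ 1

end FreeLoci

namespace FreeLoci

open Matrix

section Nilpotent

/-! Both directions rest on one factorization. The codimension condition says `E j = c j φ` with a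
common row `φ`. Joint nilpotency makes `1 - ∑ N j x j` invertible over the free algebra, so `r = φ
(1 - ∑ N j x j)⁻¹` has polynomial entries and, with `C = ∑ c j x j`, `L = (1 - C r)(1 - ∑ N j x j)`.
Since `det (1 - C r) = det (1 - r C)`, the locus of `L` is that of the polynomial `1 - r C`
(`det_pencil_eq_zero_iff`). Conversely, with words of bounded length as states and appending a
letter as `N j`, the row `r` lists all these words, so `1 - r C` can be any polynomial with constant
term 1. -/

/-- If all products of `m` of the elements `a j` vanish, then `(∑ j, a j) ^ m = 0`. -/
theorem sum_pow_eq_zero_of_words {R κ : Type*} [Semiring R] [Fintype κ] (a : κ → R) (m : ℕ)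
    (h : ∀ w : List κ, w.length = m → (w.map a).prod = 0) : (∑ j, a j) ^ m = 0 := by
  -- Generalized to a prefix word, so that induction can move one factor of the power into the
  -- prefix.
  have key : ∀ k : ℕ, ∀ w : List κ, w.length + k = m →
      (w.map a).prod * (∑ j, a j) ^ k = 0 := by
    intro k
    induction k with
    | zero => intro w hw; simpa using h w hw
    | succ k ih =>
      intro w hw
      rw [pow_succ', ← mul_assoc, Finset.mul_sum, Finset.sum_mul]
      refine Finset.sum_eq_zero fun j _ => ?_
      have := ih (w ++ [j]) (by simp; omega)
      simpa using this
  simpa using key m [] (by simp)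

end Nilpotent

variable {K : Type*} [Field K] {g : ℕ} {ι : Type*}

/-- The monomial in the free algebra corresponding to a word. -/
def monomialWord (w : List (Fin g)) : NCPoly K g := (w.map (FreeAlgebra.ι K)).prod

/-- The coefficient matrix `∑ j, N j * x j` over the free algebra. -/
def genericPencil (N : Fin g → Matrix ι ι K) : Matrix ι ι (NCPoly K g) :=
  ∑ j, (N j).map fun t => t • FreeAlgebra.ι K j

theorem prod_map_smul_generator [Fintype ι] [DecidableEq ι] (N : Fin g → Matrix ι ι K)
    (w : List (Fin g)) :
    (w.map fun j => (N j).map fun t => t • FreeAlgebra.ι K j).prod =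
      ((w.map N).prod).map fun t => t • (monomialWord w : NCPoly K g) := by
  induction w with
  | nil =>
    ext i k
    by_cases h : i = k <;> simp [monomialWord, h]
  | cons j w ih =>
    ext i k
    simp [ih, Matrix.mul_apply, monomialWord, Finset.sum_smul, smul_smul, mul_comm]

theorem isNilpotent_genericPencil {d : ℕ} {N : Fin g → Matrix (Fin d) (Fin d) K}
    (hN : JointlyNilpotent N) : IsNilpotent (genericPencil N) := by
  obtain ⟨m, hm⟩ := hN
  refine ⟨m, sum_pow_eq_zero_of_words _ m fun w hw => ?_⟩
  rw [prod_map_smul_generator, hm w hw]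
  ext; simp

theorem isUnit_one_sub_genericPencil {d : ℕ} {N : Fin g → Matrix (Fin d) (Fin d) K}
    (hN : JointlyNilpotent N) : IsUnit (1 - genericPencil N) :=
  (isNilpotent_genericPencil hN).isUnit_one_sub

/-- Entrywise evaluation of a matrix over the free algebra, as a block matrix. -/
def blockEval [Fintype ι] [DecidableEq ι] {n : ℕ} (X : Fin g → Matrix (Fin n) (Fin n) K) :
    Matrix ι ι (NCPoly K g) →+* Matrix (ι × Fin n) (ι × Fin n) K :=
  (Matrix.compRingEquiv ι (Fin n) K).toRingHom.comp
    (FreeAlgebra.lift K X).toRingHom.mapMatrix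

theorem blockEval_apply [Fintype ι] [DecidableEq ι] {n : ℕ}
    (X : Fin g → Matrix (Fin n) (Fin n) K) (M : Matrix ι ι (NCPoly K g)) (p q : ι × Fin n) :
    blockEval X M p q = FreeAlgebra.lift K X (M p.1 q.1) p.2 q.2 := rfl

theorem blockEval_genericPencil [Fintype ι] [DecidableEq ι] {n : ℕ}
    (X : Fin g → Matrix (Fin n) (Fin n) K) (N : Fin g → Matrix ι ι K) :
    blockEval X (genericPencil N) = ∑ j, N j ⊗ₖ X j := by
  ext p q
  simp [blockEval_apply, genericPencil, Matrix.sum_apply, Matrix.kroneckerMap_apply]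

/-- Let the row `r` over the free algebra solve `r (1 - ∑ N j x j) = φ`. Then the pencil with
coefficients `N j + c j φ` is, up to the determinant of `1 - ∑ N j x j`, the polynomial
`1 - r (∑ c j x j)`. -/
theorem det_pencil_eq [Fintype ι] [DecidableEq ι] (N : Fin g → Matrix ι ι K)
    (c : Fin g → ι → K) (φ : ι → K) (r : ι → NCPoly K g)
    (hr : r ᵥ* (1 - genericPencil N) = fun k => algebraMap K _ (φ k))
    {n : ℕ} (X : Fin g → Matrix (Fin n) (Fin n) K) :
    (1 - ∑ j, (N j + vecMulVec (c j) φ) ⊗ₖ X j).det =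
      (NCPoly.eval X (1 - ∑ j, (∑ i, c j i • r i) * FreeAlgebra.ι K j)).det *
        (blockEval X (1 - genericPencil N)).det := by
  -- `C` and `R` are the values at `X` of the column `∑ c j x j` and the row `r`.
  let C : Matrix (ι × Fin n) (Fin n) K := Matrix.of fun p b => ∑ j, c j p.1 * X j p.2 b
  let R : Matrix (Fin n) (ι × Fin n) K := Matrix.of fun a q => FreeAlgebra.lift K X (r q.1) a q.2
  have hRM : ∀ (a : Fin n) (q : ι × Fin n),
      (R * blockEval X (1 - genericPencil N) : Matrix (Fin n) (ι × Fin n) K) a q =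
      if a = q.2 then φ q.1 else 0 := by
    intro a q
    have h1 := congrArg (fun M => FreeAlgebra.lift K X M a q.2) (congrFun hr q.1)
    simp only [Matrix.vecMul, dotProduct, map_sum, map_mul, Matrix.sum_apply, Matrix.mul_apply,
      AlgHom.commutes, Matrix.algebraMap_matrix_apply] at h1
    rw [Matrix.mul_apply, Fintype.sum_prod_type]
    simpa [R, blockEval_apply] using h1
  have hL : (1 - ∑ j, (N j + vecMulVec (c j) φ) ⊗ₖ X j) =
      (1 - C * R) * blockEval X (1 - genericPencil N) := by
    rw [sub_mul, one_mul, Matrix.mul_assoc]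
    rw [map_sub, map_one, blockEval_genericPencil]
    have : C * (R * (1 - ∑ j, N j ⊗ₖ X j)) = ∑ j, vecMulVec (c j) φ ⊗ₖ X j := by
      rw [← blockEval_genericPencil, ← map_one (blockEval X), ← map_sub]
      ext p q
      simp only [Matrix.mul_apply (M := C), hRM, Matrix.sum_apply, Matrix.kroneckerMap_apply,
        vecMulVec_apply, C, Matrix.of_apply]
      simp [Finset.sum_mul]
      exact Finset.sum_congr rfl fun j _ => by ring
    rw [this, sub_sub, ← Finset.sum_add_distrib]
    simp only [Matrix.add_kronecker]
  have hRC : 1 - R * C = NCPoly.eval X (1 - ∑ j, (∑ i, c j i • r i) * FreeAlgebra.ι K j) := by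
    simp only [NCPoly.eval, map_sub, map_one, map_sum, map_mul, map_smul, FreeAlgebra.lift_ι_apply]
    congr 1
    ext a b
    simp only [Matrix.mul_apply, Matrix.sum_apply, Fintype.sum_prod_type, Matrix.smul_apply, R, C,
      Matrix.of_apply, Finset.mul_sum, Finset.sum_mul, smul_eq_mul]
    rw [Finset.sum_congr rfl fun i _ => Finset.sum_comm, Finset.sum_comm]
    refine Finset.sum_congr rfl fun j _ => ?_
    exact Finset.sum_congr rfl fun l _ => Finset.sum_congr rfl fun i _ => by ring
  rw [hL, Matrix.det_mul, Matrix.det_one_sub_mul_comm, hRC]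

theorem det_pencil_eq_zero_iff {d : ℕ} {N : Fin g → Matrix (Fin d) (Fin d) K}
    (hN : JointlyNilpotent N) (c : Fin g → Fin d → K) (φ : Fin d → K) (r : Fin d → NCPoly K g)
    (hr : r ᵥ* (1 - genericPencil N) = fun k => algebraMap K _ (φ k))
    {n : ℕ} (X : Fin g → Matrix (Fin n) (Fin n) K) :
    (1 - ∑ j, (N j + vecMulVec (c j) φ) ⊗ₖ X j).det = 0 ↔
      (NCPoly.eval X (1 - ∑ j, (∑ i, c j i • r i) * FreeAlgebra.ι K j)).det = 0 := by
  have hu : (blockEval X (1 - genericPencil N)).det ≠ 0 :=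
    ((Matrix.isUnit_iff_isUnit_det _).1
      ((isUnit_one_sub_genericPencil hN).map (blockEval X))).ne_zero
  rw [det_pencil_eq N c φ r hr X, mul_eq_zero, or_iff_left hu]

/-! ### From flip-poly pencils to polynomials -/

/-- Matrices whose common kernel has codimension at most one are of the form `c j φ` with a
common row `φ`. -/
theorem exists_eq_vecMulVec_of_finrank_le_one {d : ℕ} (E : Fin g → Matrix (Fin d) (Fin d) K)
    (h : Module.finrank K ((Fin d → K) ⧸ ⨅ j, LinearMap.ker (Matrix.toLin' (E j))) ≤ 1) :
    ∃ (c : Fin g → Fin d → K) (φ : Fin d → K), ∀ j, E j = vecMulVec (c j) φ := by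
  obtain ⟨v, hv⟩ := finrank_le_one_iff.1 h
  obtain ⟨v, rfl⟩ := Submodule.Quotient.mk_surjective _ v
  choose φ hφ using fun i : Fin d => hv (Submodule.Quotient.mk (Pi.single i 1))
  -- The class of `v` spans the quotient, so the `i`-th basis vector is `φ i • v` modulo the common
  -- kernel; apply `E j`.
  refine ⟨fun j => E j *ᵥ v, φ, fun j => ?_⟩
  ext a i
  have h1 := hφ i
  rw [← Submodule.Quotient.mk_smul, Submodule.Quotient.eq, Submodule.mem_iInf] at h1
  have h2 := congrFun (LinearMap.mem_ker.1 (h1 j)) a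
  simp [Matrix.mulVec_sub, Matrix.mulVec_smul, sub_eq_zero] at h2
  rw [vecMulVec_apply, mul_comm, h2]

theorem finrank_quotient_iInf_ker_vecMulVec_le_one {d : ℕ} (c : Fin g → Fin d → K)
    (φ : Fin d → K) :
    Module.finrank K
      ((Fin d → K) ⧸ ⨅ j, LinearMap.ker (Matrix.toLin' (vecMulVec (c j) φ))) ≤ 1 := by
  let ℓ : (Fin d → K) →ₗ[K] K := dotProductBilin K K φ
  have hle : LinearMap.ker ℓ ≤ ⨅ j, LinearMap.ker (Matrix.toLin' (vecMulVec (c j) φ)) := by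
    refine le_iInf fun j v hv => ?_
    have hv' : φ ⬝ᵥ v = 0 := hv
    simp [LinearMap.mem_ker, Matrix.vecMulVec_mulVec, hv']
  calc _ ≤ Module.finrank K ((Fin d → K) ⧸ LinearMap.ker ℓ) :=
        LinearMap.finrank_le_finrank_of_surjective (f := Submodule.factor hle)
          (Submodule.factor_surjective hle)
    _ = Module.finrank K (LinearMap.range ℓ) := ℓ.quotKerEquivRange.finrank_eq
    _ ≤ Module.finrank K K := Submodule.finrank_le _
    _ = 1 := Module.finrank_self K

theorem exists_poly_of_isFlipPoly (L : MonicPencil K g) (hL : L.IsFlipPoly) :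
    ∃ f : NCPoly K g, NCPoly.eval (0 : Fin g → K) f ≠ 0 ∧ f.freeLocus = L.freeLocus := by
  obtain ⟨N, E, hA, hN, hE⟩ := hL
  obtain ⟨c, φ, hc⟩ := exists_eq_vecMulVec_of_finrank_le_one E hE
  obtain ⟨u, hu⟩ := isUnit_one_sub_genericPencil hN
  let r : Fin L.size → NCPoly K g := (fun k => algebraMap K _ (φ k)) ᵥ* (↑u⁻¹ : Matrix _ _ _)
  have hr : r ᵥ* (1 - genericPencil N) = fun k => algebraMap K _ (φ k) := by
    rw [← hu, Matrix.vecMul_vecMul, Units.inv_mul, Matrix.vecMul_one]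
  refine ⟨1 - ∑ j, (∑ i, c j i • r i) * FreeAlgebra.ι K j, by simp [NCPoly.eval], ?_⟩
  ext X
  simp only [NCPoly.freeLocus, MonicPencil.freeLocus, MonicPencil.eval, Set.mem_ofPred_eq, hA, hc]
  exact (det_pencil_eq_zero_iff hN c φ r hr X.2).symm

/-! ### From polynomials to flip-poly pencils -/

theorem exists_eq_algebraMap_add_sum_mul_generator (f : NCPoly K g) :
    ∃ (t : K) (p : Fin g → NCPoly K g),
      f = algebraMap K _ t + ∑ j, p j * FreeAlgebra.ι K j := by
  induction f using FreeAlgebra.induction with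
  | grade0 t => exact ⟨t, 0, by simp⟩
  | grade1 j => exact ⟨0, Pi.single j 1, by simp [Pi.single_apply]⟩
  | mul a b ha hb =>
    obtain ⟨s, p, hp⟩ := ha
    obtain ⟨t, q, hq⟩ := hb
    refine ⟨s * t, fun j => t • p j + a * q j, ?_⟩
    -- Only the right factor is expanded, because the letters are split off on the right.
    have hab : a * b = t • a + ∑ j, a * q j * FreeAlgebra.ι K j := by
      conv_lhs => rw [hq, mul_add, ← Algebra.commutes, ← Algebra.smul_def, Finset.mul_sum]
      simp only [mul_assoc]
    have hta : t • a = algebraMap K _ (s * t) + ∑ j, t • p j * FreeAlgebra.ι K j := by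
      conv_lhs => rw [hp]
      simp only [smul_add, Finset.smul_sum, smul_mul_assoc, Algebra.algebraMap_eq_smul_one,
        smul_smul, mul_comm]
    rw [hab, hta]
    simp only [add_mul, Finset.sum_add_distrib, add_assoc]
  | add a b ha hb =>
    obtain ⟨s, p, rfl⟩ := ha
    obtain ⟨t, q, rfl⟩ := hb
    refine ⟨s + t, p + q, ?_⟩
    simp only [map_add, Pi.add_apply, add_mul, Finset.sum_add_distrib]
    abel

theorem span_range_monomialWord :
    Submodule.span K (Set.range (monomialWord : List (Fin g) → NCPoly K g)) = ⊤ := by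
  have h := Algebra.adjoin_eq_span K (Set.range (FreeAlgebra.ι K : Fin g → NCPoly K g))
  rw [FreeAlgebra.adjoin_range_ι, Algebra.top_toSubmodule] at h
  rw [eq_top_iff, h]
  refine Submodule.span_mono ?_
  intro x hx
  rw [← FreeMonoid.mrange_lift] at hx
  obtain ⟨w, rfl⟩ := hx
  exact ⟨w.toList, (FreeMonoid.lift_apply _ _).symm⟩

/-- Polynomials are linear combinations of words of bounded length. -/
theorem exists_eq_sum_monomialWord (p : Fin g → NCPoly K g) :
    ∃ (m : ℕ) (a : Fin g → List (Fin g) →₀ K), (∀ j, ∀ w ∈ (a j).support, w.length ≤ m) ∧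
      ∀ j, p j = (a j).sum fun w t => t • monomialWord w := by
  have h : ∀ j, ∃ a : List (Fin g) →₀ K, (a.sum fun w t => t • monomialWord w) = p j := fun j =>
    Finsupp.mem_span_range_iff_exists_finsupp.1 (by rw [span_range_monomialWord]; trivial)
  choose a ha using h
  refine ⟨Finset.univ.sup fun j => (a j).support.sup List.length, a, fun j w hw => ?_,
    fun j => (ha j).symm⟩
  exact (Finset.le_sup (f := List.length) hw).trans
    (Finset.le_sup (f := fun j => (a j).support.sup List.length) (Finset.mem_univ j))

/-- The shift matrices on states labelled by words. -/
def wordShift {d : ℕ} (e : Fin d → List (Fin g)) (j : Fin g) : Matrix (Fin d) (Fin d) K :=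
  Matrix.of fun i k => if e k = e i ++ [j] then 1 else 0

theorem jointlyNilpotent_wordShift {d : ℕ} (e : Fin d → List (Fin g)) (m : ℕ)
    (he : ∀ i, (e i).length ≤ m) :
    JointlyNilpotent (wordShift e : Fin g → Matrix (Fin d) (Fin d) K) := by
  -- Each shift lengthens the state by one letter, so bounded length kills products of `m + 1`
  -- shifts.
  have key : ∀ (w : List (Fin g)) (i k : Fin d),
      (w.map (wordShift (K := K) e)).prod i k ≠ 0 →
        (e k).length = (e i).length + w.length := by
    intro w
    induction w with
    | nil =>
      intro i k h
      by_cases hik : i = k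
      · simp [hik]
      · simp [hik] at h
    | cons j w ih =>
      intro i k h
      rw [List.map_cons, List.prod_cons, Matrix.mul_apply] at h
      obtain ⟨l, -, hl⟩ := Finset.exists_ne_zero_of_sum_ne_zero h
      have h2 := ih l k (right_ne_zero_of_mul hl)
      have h1 : e l = e i ++ [j] := by
        by_contra hne
        exact left_ne_zero_of_mul hl (by simp [wordShift, hne])
      rw [h2, h1]
      simp
      omega
  refine ⟨m + 1, fun w hw => ?_⟩
  ext i k
  by_contra h
  have := key w i k h
  have := he k
  omega

/-- A nonempty word is uniquely a shorter word times its last letter, so it cancels against that one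
term; only the empty word survives. -/
theorem vecMul_one_sub_genericPencil_wordShift {d : ℕ} (m : ℕ)
    (e : Fin d ≃ {w : List (Fin g) // w.length ≤ m}) :
    (fun i => (monomialWord (e i).1 : NCPoly K g)) ᵥ*
        (1 - genericPencil (wordShift fun i => (e i).1)) =
      fun k => algebraMap K _ (if (e k).1 = [] then 1 else 0) := by
  funext k
  rw [Matrix.vecMul_sub, Matrix.vecMul_one, Pi.sub_apply, sub_eq_iff_eq_add]
  simp only [Matrix.vecMul, dotProduct, genericPencil, Matrix.sum_apply, Matrix.map_apply,
    wordShift, Matrix.of_apply, ite_smul, one_smul, zero_smul, Finset.mul_sum, mul_ite, mul_zero]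
  rcases List.eq_nil_or_concat' (e k).1 with h | ⟨w, j, h⟩
  · simp [h, monomialWord]
  · have hw : w.length ≤ m := by
      have := (e k).2
      rw [h] at this
      simp at this
      omega
    rw [Finset.sum_eq_single (e.symm ⟨w, hw⟩), Finset.sum_eq_single j]
    · simp [h, monomialWord]
    · intro j' _ hj
      simp [h, hj.symm]
    · simp
    · intro i _ hi
      refine Finset.sum_eq_zero fun j' _ => if_neg fun h' => hi ?_
      rw [h] at h'
      rw [Equiv.eq_symm_apply]
      exact Subtype.ext (List.append_inj_left' h' rfl).symm
    · simp

theorem exists_isFlipPoly_of_poly (f : NCPoly K g) (hf : NCPoly.eval (0 : Fin g → K) f ≠ 0) :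
    ∃ L : MonicPencil K g, L.IsFlipPoly ∧ L.freeLocus = f.freeLocus := by
  obtain ⟨t, p, rfl⟩ := exists_eq_algebraMap_add_sum_mul_generator f
  have ht : t ≠ 0 := by simpa [NCPoly.eval] using hf
  obtain ⟨m, a, ham, hap⟩ := exists_eq_sum_monomialWord p
  have : Finite {w : List (Fin g) // w.length ≤ m} := List.finite_length_le (Fin g) m
  obtain ⟨d, ⟨e'⟩⟩ := Finite.exists_equiv_fin {w : List (Fin g) // w.length ≤ m}
  let e := e'.symm
  -- The empty word is always a state.
  have hd : 0 < d := (e.symm ⟨[], by simp⟩).pos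
  let N : Fin g → Matrix (Fin d) (Fin d) K := wordShift fun i => (e i).1
  have hN : JointlyNilpotent N := jointlyNilpotent_wordShift _ m fun i => (e i).2
  -- Chosen so that `t + ∑ p j x j = t (1 - r C)`.
  let c : Fin g → Fin d → K := fun j i => -(t⁻¹ * a j (e i).1)
  let φ : Fin d → K := fun k => if (e k).1 = [] then 1 else 0
  refine ⟨⟨⟨d, hd⟩, fun j => N j + vecMulVec (c j) φ⟩,
    ⟨N, fun j => vecMulVec (c j) φ, fun _ => rfl, hN,
      finrank_quotient_iInf_ker_vecMulVec_le_one c φ⟩, ?_⟩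
  have hp : ∀ j, ∑ i, c j i • (monomialWord (e i).1 : NCPoly K g) = -(t⁻¹ • p j) := by
    intro j
    rw [hap j]
    simp only [c, neg_smul, Finset.sum_neg_distrib, mul_smul, ← Finset.smul_sum]
    congr 2
    have hinj : Function.Injective fun i => (e i).1 := Subtype.val_injective.comp e.injective
    rw [Finsupp.sum_of_support_subset (a j) (s := Finset.univ.image fun i => (e i).1) _ _
      (by simp), Finset.sum_image hinj.injOn]
    intro w hw
    exact Finset.mem_image.2 ⟨e.symm ⟨w, ham j w hw⟩, Finset.mem_univ _, by simp⟩
  have hfac : algebraMap K (NCPoly K g) t + ∑ j, p j * FreeAlgebra.ι K j =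
      t • (1 - ∑ j, (∑ i, c j i • monomialWord (e i).1) * FreeAlgebra.ι K j) := by
    simp [hp, smul_add, Finset.smul_sum, smul_smul, ht, Algebra.algebraMap_eq_smul_one]
  ext X
  have h := det_pencil_eq_zero_iff hN c φ _ (vecMul_one_sub_genericPencil_wordShift m e) X.2
  simp only [NCPoly.freeLocus, MonicPencil.freeLocus, MonicPencil.eval, Set.mem_ofPred_eq]
  refine h.trans ?_
  rw [hfac]
  simp only [NCPoly.eval, map_smul, Matrix.det_smul]
  simp [ht]

end FreeLoci

theorem corollary5p5 (K : Type*) [Field K] [IsAlgClosed K] [CharZero K] (g : ℕ) :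
    {V : Set (FreeLoci.MatTuple K g) |
        ∃ f : FreeLoci.NCPoly K g,
          FreeLoci.NCPoly.eval (0 : Fin g → K) f ≠ 0 ∧ f.freeLocus = V} =
      {V : Set (FreeLoci.MatTuple K g) |
        ∃ L : FreeLoci.MonicPencil K g, L.IsFlipPoly ∧ L.freeLocus = V} := by
  ext V
  constructor
  · rintro ⟨f, hf, rfl⟩
    exact FreeLoci.exists_isFlipPoly_of_poly f hf
  · rintro ⟨L, hL, rfl⟩
    exact FreeLoci.exists_poly_of_isFlipPoly L hL
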